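/- For complex $a,q$ with $|q|<1$ write $(a;q)_m=\prod_{j=0}^{m-1}(1-aq^j)$, $(a;q)_\infty=\prod_{j\ge 0}(1-aq^j)$ and $(a,b,c;q)_\infty=(a;q)_\infty(b;q)_\infty(c;q)_\infty$. Then for every complex $q$ with $|q|<1$ (and $q\neq 0$ in the third and fourth identities, where negative powers of $q$ are written) the following double series over integers $n,r\ge 0$ converge absolutely, with the stated sums: $$\sum_{n,r\ge 0}\frac{q^{n^2+2r^2+3nr+2n+3r}(q;q)_{n+r+1}}{(q;q)_{2n+2r+2}(q;q)_r(q;q)_n}=\frac{(q,q^{10},q^{11};q^{11})_\infty}{(q;q)_\infty},$$ $$\sum_{n,r\ge 0}\frac{q^{n^2+2r^2+3nr+2n+3r}(q;q)_{n+r+1}\,(1+q^{n+1}+q^n-q^{2n})}{(q;q)_{2n+2r+2}(q;q)_r(q;q)_n}=\frac{(q^2,q^9,q^{11};q^{11})_\infty}{(q;q)_\infty},$$ $$\sum_{n,r\ge 0}\frac{q^{n^2+2r^2+3nr}(q;q)_{n+r}\,\bigl[(q^{n-1}+q^n-q^{2n-1})-(q^{-1}+q^{n-2}+q^{n-1}-q^{2n-4})(1-q^{n-1})(1-q^n)\bigr]}{(q;q)_{2n+2r}(q;q)_r(q;q)_n}=\frac{(q^3,q^8,q^{11};q^{11})_\infty}{(q;q)_\infty},$$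 $$\sum_{n,r\ge 0}\frac{q^{n^2+2r^2+3nr}(q;q)_{n+r}\,(q^{n-1}+q^n-q^{2n-1})}{(q;q)_{2n+2r}(q;q)_r(q;q)_n}=\frac{(q^4,q^7,q^{11};q^{11})_\infty}{(q;q)_\infty},$$ $$\sum_{n,r\ge 0}\frac{q^{n^2+2r^2+3nr}(q;q)_{n+r}}{(q;q)_{2n+2r}(q;q)_r(q;q)_n}=\frac{(q^5,q^6,q^{11};q^{11})_\infty}{(q;q)_\infty}.$$ -/

import Mathlib

/-- The finite `q`-shifted factorial `(a; q)_m = ∏_{j=0}^{m-1} (1 - a q^j)`. -/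
noncomputable def qPoch (a q : ℂ) (m : ℕ) : ℂ :=
  ∏ j ∈ Finset.range m, (1 - a * q ^ j)

/-- The infinite `q`-shifted factorial `(a; q)_∞ = ∏_{j=0}^∞ (1 - a q^j)`. -/
noncomputable def qPochInf (a q : ℂ) : ℂ :=
  ∏' j : ℕ, (1 - a * q ^ j)

/-- `(a, b, c; q)_∞ = (a; q)_∞ (b; q)_∞ (c; q)_∞`. -/
noncomputable def qPochInf3 (a b c q : ℂ) : ℂ :=
  qPochInf a q * qPochInf b q * qPochInf c q

/-- For `|q| < 1` the infinite product defining `(a; q)_∞` converges (so `qPochInf` is never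
the default value of `∏'` there). -/
theorem qPochInf_hasProd (a q : ℂ) (hq : ‖q‖ < 1) :
    HasProd (fun j : ℕ => 1 - a * q ^ j) (qPochInf a q) := by
  have h : Summable fun j : ℕ => ‖-(a * q ^ j)‖ := by
    simp only [norm_neg, norm_mul, norm_pow]
    exact (summable_geometric_of_lt_one (norm_nonneg q) hq).mul_left _
  have h2 := multipliable_one_add_of_summable h
  simp only [← sub_eq_add_neg] at h2
  exact h2.hasProd

/-! Since `n² + 2r² + 3nr = (n+r)² + (n+r)r`, grouping a double series by `N = n + r` produces `∑_N
q^{N²} S_N`. Here `S_N` is `(q;q)_N/(q;q)_{2N}` times a finite sum over `n + r = N`, that is, a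
combination of the Rogers–Szegő-type sums `rogersSzego q N k`.

The finite heart is `pentSum_eq_rogersSzego`: for five choices of parameters such an `S_N` equals a
signed sum `∑_j (-1)^j q^{j(3j+1)/2+dj} / ((q;q)_{N-s-2j} (q;q)_{N+s+2j})` with `s = 0` or `1`. This
is a Bailey pair supported on indices of one parity. Both sides satisfy linear recurrences in `N`,
and the five identities are proved by one simultaneous induction.

The limiting Bailey lemma `hasSum_pow_sq_mul_qPochRecip` then sums over `N` and replaces the two
reciprocals by `q^{(2j+s)²}/(q;q)_∞`. The exponent of `q` becomes quadratic in `j` with leading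
coefficient `3/2 + 4 = 11/2`, so `jacobi_triple_product` with base `q^11` gives the product
(`hasSum_pentSum`). The values `s = 0`, `d = 0, 1, 2` give the last three identities in reverse
order; `s = 1`, `d = 0, -1` give the first two. -/

open Filter Topology

/-! ### Reciprocal q-factorials at integer indices -/

/-- The reciprocal `1 / (q; q)_k`, extended by `0` to negative integers `k`. -/
noncomputable def qPochRecip (q : ℂ) (k : ℤ) : ℂ :=
  if 0 ≤ k then (qPoch q q k.toNat)⁻¹ else 0

theorem one_sub_pow_ne_zero {q : ℂ} (hq : ‖q‖ < 1) {k : ℕ} (hk : k ≠ 0) : 1 - q ^ k ≠ 0 := by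
  intro h
  have h1 : ‖q ^ k‖ = 1 := by rw [← sub_eq_zero.mp h]; simp
  rw [norm_pow] at h1
  exact (pow_lt_one₀ (norm_nonneg q) hq hk).ne h1

theorem qPoch_zero (a q : ℂ) : qPoch a q 0 = 1 := by simp [qPoch]

theorem qPoch_succ (a q : ℂ) (m : ℕ) : qPoch a q (m + 1) = qPoch a q m * (1 - a * q ^ m) :=
  Finset.prod_range_succ _ _

theorem qPoch_self_succ (q : ℂ) (m : ℕ) :
    qPoch q q (m + 1) = qPoch q q m * (1 - q ^ (m + 1)) := by
  rw [qPoch_succ, pow_succ']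

theorem qPoch_self_ne_zero {q : ℂ} (hq : ‖q‖ < 1) (m : ℕ) : qPoch q q m ≠ 0 := by
  refine Finset.prod_ne_zero_iff.mpr fun j _ => ?_
  rw [← pow_succ']
  exact one_sub_pow_ne_zero hq j.succ_ne_zero

theorem qPochRecip_natCast (q : ℂ) (k : ℕ) : qPochRecip q k = (qPoch q q k)⁻¹ := by
  simp [qPochRecip]

theorem qPochRecip_of_neg (q : ℂ) {k : ℤ} (hk : k < 0) : qPochRecip q k = 0 := by
  simp [qPochRecip, hk]

theorem qPochRecip_zero (q : ℂ) : qPochRecip q 0 = 1 := by simp [qPochRecip, qPoch_zero]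

/-- Extension by zero makes this valid for every integer: at `k = 0` the factor `1 - q^0` vanishes.
All later recurrences can therefore ignore the boundary of summation. -/
theorem qPochRecip_sub_one {q : ℂ} (hq : ‖q‖ < 1) (k : ℤ) :
    qPochRecip q (k - 1) = (1 - q ^ k) * qPochRecip q k := by
  rcases lt_trichotomy k 0 with h | rfl | h
  · rw [qPochRecip_of_neg q h, qPochRecip_of_neg q (by omega), mul_zero]
  · rw [qPochRecip_of_neg q (by omega)]; simp
  · obtain ⟨m, rfl⟩ : ∃ m : ℕ, k = (m + 1 : ℕ) := ⟨(k - 1).toNat, by omega⟩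
    have : ((m + 1 : ℕ) : ℤ) - 1 = (m : ℕ) := by push_cast; ring
    rw [this, qPochRecip_natCast, qPochRecip_natCast, qPoch_self_succ, zpow_natCast]
    have h1 := qPoch_self_ne_zero hq m
    have h2 := one_sub_pow_ne_zero hq m.succ_ne_zero
    field_simp

/-! ### Signed sums with pentagonal exponents and their recurrences -/

/-- The signed power `(-1)^j q^{j(3j+1)/2 + dj}`. -/
noncomputable def pentWeight (q : ℂ) (d j : ℤ) : ℂ :=
  (-1) ^ j * q ^ (j * (3 * j + 1) / 2 + d * j)

theorem pentagonal_div_two (j : ℤ) : 2 * (j * (3 * j + 1) / 2) = j * (3 * j + 1) := by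
  apply Int.mul_ediv_cancel'
  rcases Int.even_or_odd j with ⟨k, rfl⟩ | ⟨k, rfl⟩
  · exact ⟨k * (3 * (k + k) + 1), by ring⟩
  · exact ⟨(2 * k + 1) * (3 * k + 2), by ring⟩

theorem pentWeight_neg (q : ℂ) (d j : ℤ) : pentWeight q d (-j) = pentWeight q (-d - 1) j := by
  have h1 := pentagonal_div_two j
  have h2 := pentagonal_div_two (-j)
  have : -j * (3 * -j + 1) / 2 + d * -j = j * (3 * j + 1) / 2 + (-d - 1) * j := by linarith
  rw [pentWeight, pentWeight, this, zpow_neg, ← inv_zpow]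
  norm_num

theorem pentWeight_add_one {q : ℂ} (h0 : q ≠ 0) (d j : ℤ) :
    pentWeight q d (j + 1) = -q ^ (d + 2) * pentWeight q (d + 3) j := by
  have h1 := pentagonal_div_two j
  have h2 := pentagonal_div_two (j + 1)
  have : (j + 1) * (3 * (j + 1) + 1) / 2 + d * (j + 1) =
    (d + 2) + (j * (3 * j + 1) / 2 + (d + 3) * j) := by linarith
  rw [pentWeight, pentWeight, this, zpow_add₀ h0, zpow_add₀ (by norm_num)]
  ring

theorem zpow_mul_pentWeight {q : ℂ} (h0 : q ≠ 0) (c d j : ℤ) :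
    q ^ (c * j) * pentWeight q d j = pentWeight q (d + c) j := by
  have : j * (3 * j + 1) / 2 + (d + c) * j = c * j + (j * (3 * j + 1) / 2 + d * j) := by ring
  rw [pentWeight, pentWeight, this, zpow_add₀ h0 (c * j)]
  ring

/-- The sum `∑_j (-1)^j q^{j(3j+1)/2 + dj} / ((q; q)_{a-2j} (q; q)_{b+2j})`. -/
noncomputable def pentSum (q : ℂ) (d a b : ℤ) : ℂ :=
  ∑' j : ℤ, pentWeight q d j * (qPochRecip q (a - 2 * j) * qPochRecip q (b + 2 * j))

theorem qPochRecip_mul_eq_zero (q : ℂ) {a b j : ℤ} (hj : j ∉ Finset.Icc (-|b|) |a|) :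
    qPochRecip q (a - 2 * j) * qPochRecip q (b + 2 * j) = 0 := by
  rw [Finset.mem_Icc, not_and_or, not_le, not_le] at hj
  have h1 := le_abs_self a
  have h2 := le_abs_self b
  have h3 := abs_nonneg a
  have h4 := abs_nonneg b
  rcases hj with h | h
  · rw [qPochRecip_of_neg q (by omega : b + 2 * j < 0), mul_zero]
  · rw [qPochRecip_of_neg q (by omega : a - 2 * j < 0), zero_mul]

theorem summable_qPochRecip_mul (q : ℂ) (f : ℤ → ℂ) (a b : ℤ) :
    Summable fun j : ℤ => f j * (qPochRecip q (a - 2 * j) * qPochRecip q (b + 2 * j)) :=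
  summable_of_ne_finset_zero (s := Finset.Icc (-|b|) |a|) fun j hj => by
    rw [qPochRecip_mul_eq_zero q hj, mul_zero]

theorem pentSum_comm (q : ℂ) (d a b : ℤ) : pentSum q d a b = pentSum q (-d - 1) b a := by
  rw [pentSum, ← (Equiv.neg ℤ).tsum_eq]
  refine tsum_congr fun j => ?_
  simp only [Equiv.neg_apply, pentWeight_neg]
  rw [mul_comm (qPochRecip _ _)]
  ring_nf

/-- Reindexing by `j ↦ j + 1`; together with the reflection `j ↦ -j` of `pentSum_comm`, it reduces
the parameters met below to a short list. -/
theorem pentSum_shift {q : ℂ} (h0 : q ≠ 0) (d a b : ℤ) :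
    pentSum q d a b = -q ^ (d + 2) * pentSum q (d + 3) (a - 2) (b + 2) := by
  rw [pentSum, ← (Equiv.addRight (1 : ℤ)).tsum_eq, pentSum, ← tsum_mul_left]
  refine tsum_congr fun j => ?_
  simp only [Equiv.coe_addRight, pentWeight_add_one h0]
  ring_nf

/-- Lowering both indices inserts `(1 - q^{a-2j})(1 - q^{b+2j})`; in the expansion, a factor
`q^{∓2j}` moves `d` by `∓2`. -/
theorem pentSum_sub_one_sub_one {q : ℂ} (h0 : q ≠ 0) (hq : ‖q‖ < 1) (d a b : ℤ) :
    pentSum q d (a - 1) (b - 1) = (1 + q ^ (a + b)) * pentSum q d a b -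
      q ^ a * pentSum q (d - 2) a b - q ^ b * pentSum q (d + 2) a b := by
  simp only [pentSum, ← tsum_mul_left]
  rw [← Summable.tsum_sub, ← Summable.tsum_sub]
  · refine tsum_congr fun j => ?_
    rw [sub_right_comm, ← add_sub_right_comm, qPochRecip_sub_one hq, qPochRecip_sub_one hq,
      ← zpow_mul_pentWeight h0 2, sub_eq_add_neg d, ← zpow_mul_pentWeight h0 (-2),
      zpow_sub₀ h0, zpow_add₀ h0, zpow_add₀ h0, neg_mul, zpow_neg]
    have : q ^ (2 * j) ≠ 0 := zpow_ne_zero _ h0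
    field_simp
    ring
  all_goals
    simp only [← mul_assoc, ← sub_mul]
    simp only [mul_assoc _ (qPochRecip q _)]
    exact summable_qPochRecip_mul q _ a b

/-- After division by the common reciprocals this is a polynomial identity in `x = q^a`, `y = q^b`,
`q⁻¹`. Each product on the right has total index `a + b - 2`, so it drives the inductions on `N`
both for `pentSum` and for the finite triple product. -/
theorem qPochRecip_mul_recurrence {q : ℂ} (h0 : q ≠ 0) (hq : ‖q‖ < 1) (a b : ℤ) :
    (1 - q ^ (a + b)) * (1 - q ^ (a + b - 1)) * (qPochRecip q a * qPochRecip q b) =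
      q ^ a * (qPochRecip q a * qPochRecip q (b - 2)) +
      (1 + q ^ (a + b - 1)) * (qPochRecip q (a - 1) * qPochRecip q (b - 1)) +
      q ^ b * (qPochRecip q (a - 2) * qPochRecip q b) := by
  have e (k : ℤ) : qPochRecip q (k - 2) = (1 - q ^ (k - 1)) * ((1 - q ^ k) * qPochRecip q k) := by
    rw [← qPochRecip_sub_one hq, ← qPochRecip_sub_one hq]
    ring_nf
  rw [e, e, qPochRecip_sub_one hq, qPochRecip_sub_one hq]
  simp only [zpow_sub₀ h0, zpow_add₀ h0, zpow_one, div_eq_mul_inv]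
  generalize q ^ a = x, q ^ b = y, q⁻¹ = z
  ring

theorem zpow_mul_pentWeight_add {q : ℂ} (h0 : q ≠ 0) (a c d j : ℤ) :
    q ^ a * pentWeight q (d + c) j = q ^ (a + c * j) * pentWeight q d j := by
  rw [← zpow_mul_pentWeight h0, zpow_add₀ h0, mul_assoc]

theorem pentSum_recurrence {q : ℂ} (h0 : q ≠ 0) (hq : ‖q‖ < 1) (d a b : ℤ) :
    (1 - q ^ (a + b)) * (1 - q ^ (a + b - 1)) * pentSum q d a b =
      q ^ a * pentSum q (d - 2) a (b - 2) + (1 + q ^ (a + b - 1)) * pentSum q d (a - 1) (b - 1) +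
      q ^ b * pentSum q (d + 2) (a - 2) b := by
  have key (d a b : ℤ) (c : ℂ) : HasSum (fun j : ℤ => c * (pentWeight q d j *
      (qPochRecip q (a - 2 * j) * qPochRecip q (b + 2 * j)))) (c * pentSum q d a b) :=
    (summable_qPochRecip_mul q (pentWeight q d) a b).hasSum.mul_left c
  refine (key d a b _).unique ?_
  convert ((key (d - 2) a (b - 2) (q ^ a)).add (key d (a - 1) (b - 1) (1 + q ^ (a + b - 1)))).add
    (key (d + 2) (a - 2) b (q ^ b)) using 2 with j
  have h := qPochRecip_mul_recurrence h0 hq (a - 2 * j) (b + 2 * j)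
  have e1 := zpow_mul_pentWeight_add h0 a (-2) d j
  have e2 := zpow_mul_pentWeight_add h0 b 2 d j
  rw [show a - 2 * j + (b + 2 * j) = a + b by ring, show b + 2 * j - 2 = b - 2 + 2 * j by ring,
    show b + 2 * j - 1 = b - 1 + 2 * j by ring, show a - 2 * j - 2 = a - 2 - 2 * j by ring,
    show a - 2 * j - 1 = a - 1 - 2 * j by ring] at h
  rw [← sub_eq_add_neg, neg_mul, ← sub_eq_add_neg] at e1
  rw [← mul_assoc (q ^ a), ← mul_assoc (q ^ b), e1, e2]
  linear_combination pentWeight q d j * h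

theorem pentSum_zero_zero (q : ℂ) (d : ℤ) : pentSum q d 0 0 = 1 := by
  rw [pentSum, tsum_eq_single 0]
  · simp [pentWeight, qPochRecip_zero]
  · intro j hj
    rcases lt_or_gt_of_ne hj with h | h
    · rw [qPochRecip_of_neg q (by omega : 0 + 2 * j < 0)]; simp
    · rw [qPochRecip_of_neg q (by omega : 0 - 2 * j < 0)]; simp

theorem pentSum_neg_one_one (q : ℂ) (d : ℤ) : pentSum q d (-1) 1 = 0 := by
  rw [pentSum, ← tsum_zero]
  refine tsum_congr fun j => ?_
  rcases lt_or_ge j 0 with h | h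
  · rw [qPochRecip_of_neg q (by omega : 1 + 2 * j < 0)]; simp
  · rw [qPochRecip_of_neg q (by omega : -1 - 2 * j < 0)]; simp

/-- Reflection followed by a shift returns the same indices with `d` replaced by `2 - d`; in
particular the sum vanishes at `d = 1`. -/
theorem pentSum_odd_antisymm {q : ℂ} (h0 : q ≠ 0) (d n : ℤ) :
    pentSum q d (n - 1) (n + 1) = -q ^ (1 - d) * pentSum q (2 - d) (n - 1) (n + 1) := by
  rw [pentSum_comm, pentSum_shift h0]
  ring_nf

theorem pentSum_even_recurrence {q : ℂ} (h0 : q ≠ 0) (hq : ‖q‖ < 1) (d n : ℤ) :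
    (1 - q ^ (2 * n + 2)) * (1 - q ^ (2 * n + 1)) * pentSum q d (n + 1) (n + 1) =
      (1 + q ^ (2 * n + 1)) * pentSum q d n n + q ^ (n + 1) *
        (pentSum q (1 - d) (n - 1) (n + 1) + pentSum q (d + 2) (n - 1) (n + 1)) := by
  have h := pentSum_recurrence h0 hq d (n + 1) (n + 1)
  rw [pentSum_comm q (d - 2)] at h
  ring_nf at h ⊢
  exact h

theorem pentSum_odd_recurrence {q : ℂ} (h0 : q ≠ 0) (hq : ‖q‖ < 1) (d n : ℤ) :
    (1 - q ^ (2 * n + 2)) * (1 - q ^ (2 * n + 1)) * pentSum q d n (n + 2) =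
      (1 + q ^ (2 * n + 1)) * pentSum q d (n - 1) (n + 1) + q ^ n * pentSum q (1 - d) n n -
        q ^ (n + 1 - d) * pentSum q (-d) n n := by
  have h := pentSum_recurrence h0 hq d n (n + 2)
  have h1 := pentSum_shift h0 (d - 1) n n
  rw [pentSum_comm q (d - 2)] at h
  rw [pentSum_comm q (d - 1)] at h1
  have e : q ^ (n + 1 - d) * q ^ (d - 1 + 2) = q ^ (n + 2) := by
    rw [← zpow_add₀ h0]; congr 1; ring
  rw [show d - 1 + 3 = d + 2 by ring, show -(d - 1) - 1 = -d by ring] at h1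
  rw [h1, neg_mul, mul_neg, ← mul_assoc, e]
  rw [show n + (n + 2) = 2 * n + 2 by ring, show 2 * n + 2 - 1 = 2 * n + 1 by ring,
    show n + 2 - 2 = n by ring, show n + 2 - 1 = n + 1 by ring,
    show -(d - 2) - 1 = 1 - d by ring] at h
  linear_combination h

/-! ### Rogers–Szegő sums and contiguous relations -/

/-- The sum `∑_{n+r=N} q^{kn} q^{Nr} / ((q; q)_n (q; q)_r)`, a multiple of a Rogers–Szegő
polynomial at a power of `q`. -/
noncomputable def rogersSzego (q : ℂ) (N : ℕ) (k : ℤ) : ℂ :=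
  ∑ p ∈ Finset.HasAntidiagonal.antidiagonal N,
    (q ^ k) ^ p.1 * q ^ (N * p.2) / (qPoch q q p.1 * qPoch q q p.2)

theorem rogersSzego_zero (q : ℂ) (k : ℤ) : rogersSzego q 0 k = 1 := by
  simp [rogersSzego, qPoch_zero]

/-- The difference inserts `1 - q^n`, which kills `n = 0` and cancels the last factor of `(q;q)_n`.
The companion lemma below does the same with `1 - q^r`. -/
theorem rogersSzego_succ_sub_add_one {q : ℂ} (h0 : q ≠ 0) (hq : ‖q‖ < 1) (N : ℕ) (k : ℤ) :
    rogersSzego q (N + 1) k - rogersSzego q (N + 1) (k + 1) =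
      q ^ k * q ^ N * rogersSzego q N (k - 1) := by
  rw [rogersSzego, rogersSzego, rogersSzego, ← Finset.sum_sub_distrib,
    Finset.Nat.sum_antidiagonal_succ, Finset.mul_sum]
  simp only [pow_zero, sub_self, zero_add]
  refine Finset.sum_congr rfl fun p hp => ?_
  obtain rfl : p.1 + p.2 = N := Finset.HasAntidiagonal.mem_antidiagonal.mp hp
  have h1 := qPoch_self_ne_zero hq p.1
  have h2 := qPoch_self_ne_zero hq p.2
  have h3 := one_sub_pow_ne_zero hq p.1.succ_ne_zero
  have h4 : q ^ k ≠ 0 := zpow_ne_zero k h0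
  rw [qPoch_self_succ, zpow_add_one₀ h0, zpow_sub_one₀ h0, ← div_eq_mul_inv, div_pow]
  field_simp
  ring

theorem rogersSzego_succ_sub_sub_one {q : ℂ} (h0 : q ≠ 0) (hq : ‖q‖ < 1) (N : ℕ) (k : ℤ) :
    rogersSzego q (N + 1) k - q ^ (N + 1) * rogersSzego q (N + 1) (k - 1) =
      q ^ (N + 1) * q ^ N * rogersSzego q N (k - 1) := by
  have h4 : q ^ k ≠ 0 := zpow_ne_zero k h0
  rw [rogersSzego, rogersSzego, rogersSzego, Finset.mul_sum, ← Finset.sum_sub_distrib,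
    Finset.Nat.sum_antidiagonal_succ', Finset.mul_sum]
  rw [zpow_sub_one₀ h0, ← div_eq_mul_inv]
  simp only [div_pow]
  rw [add_eq_right.mpr]
  · refine Finset.sum_congr rfl fun p hp => ?_
    obtain rfl : p.1 + p.2 = N := Finset.HasAntidiagonal.mem_antidiagonal.mp hp
    have h1 := qPoch_self_ne_zero hq p.1
    have h2 := qPoch_self_ne_zero hq p.2
    have h3 := one_sub_pow_ne_zero hq p.2.succ_ne_zero
    rw [qPoch_self_succ]
    field_simp
    ring
  · have h1 := qPoch_self_ne_zero hq (N + 1)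
    field_simp
    ring

/-- For positive `N` both sides are the same multiple of one sum at level `N - 1`. Consequently all
values at a fixed level are determined by those at `k = 0, 1`. -/
theorem rogersSzego_three_term {q : ℂ} (h0 : q ≠ 0) (hq : ‖q‖ < 1) (N : ℕ) (k : ℤ) :
    q ^ N * (rogersSzego q N k - rogersSzego q N (k + 1)) =
      q ^ k * (rogersSzego q N k - q ^ N * rogersSzego q N (k - 1)) := by
  cases N with
  | zero => simp [rogersSzego_zero]
  | succ N =>
    rw [rogersSzego_succ_sub_add_one h0 hq, rogersSzego_succ_sub_sub_one h0 hq]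
    ring

/-! ### The finite identities -/

/-- The recurrences for one value of `d` call on others, so the five statements must be carried
together; the symmetries of `pentSum` make this list closed. -/
theorem pentSum_eq_rogersSzego {q : ℂ} (h0 : q ≠ 0) (hq : ‖q‖ < 1) (N : ℕ) :
    (pentSum q 0 N N = qPoch q q N / qPoch q q (2 * N) * rogersSzego q N 0 ∧
    pentSum q 1 N N = qPoch q q N / qPoch q q (2 * N) *
      ((q⁻¹ + 1) * rogersSzego q N 1 - q⁻¹ * rogersSzego q N 2) ∧
    pentSum q 0 (N - 1) (N + 1) = qPoch q q N / qPoch q q (2 * N) *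
      (rogersSzego q N 0 - rogersSzego q N 1)) ∧
    pentSum q 2 N N = qPoch q q N / qPoch q q (2 * N) *
      (-q⁻¹ * rogersSzego q N 0 + (q⁻¹ + 1) * rogersSzego q N 1 +
        (q⁻¹ ^ 4 + q⁻¹ ^ 3 + q⁻¹ ^ 2) * rogersSzego q N 2 -
        (q⁻¹ ^ 5 + q⁻¹ ^ 4 + q⁻¹ ^ 3 + q⁻¹ ^ 2) * rogersSzego q N 3 +
        q⁻¹ ^ 5 * rogersSzego q N 4) ∧
    pentSum q (-1) (N - 1) (N + 1) = qPoch q q N / qPoch q q (2 * N) *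
      (rogersSzego q N 0 + q⁻¹ * rogersSzego q N 1 -
        (1 + q⁻¹ + q⁻¹ ^ 2) * rogersSzego q N 2 + q⁻¹ ^ 2 * rogersSzego q N 3) := by
  induction N with
  | zero =>
    simp only [Nat.cast_zero, mul_zero, qPoch_zero, rogersSzego_zero, pentSum_zero_zero, zero_sub,
      zero_add, pentSum_neg_one_one]
    refine ⟨⟨?_, ?_, ?_⟩, ?_, ?_⟩ <;> ring
  | succ N ih =>
    obtain ⟨⟨i1, i2, i3⟩, i4, i5⟩ := ih
    have hy : q ^ N ≠ 0 := pow_ne_zero N h0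
    have d1 : 1 - q * q ^ N ≠ 0 := by
      rw [← pow_succ']; exact one_sub_pow_ne_zero hq N.succ_ne_zero
    have d2 : 1 - q ^ 2 * (q ^ N) ^ 2 ≠ 0 := by
      rw [← mul_pow, ← pow_succ', ← pow_mul]; exact one_sub_pow_ne_zero hq (by omega)
    have d3 : 1 - q * (q ^ N) ^ 2 ≠ 0 := by
      rw [← pow_mul, ← pow_succ']; exact one_sub_pow_ne_zero hq (by omega)
    -- the prefactor
    have hc : (1 - q ^ 2 * (q ^ N) ^ 2) * (1 - q * (q ^ N) ^ 2) *
        (qPoch q q (N + 1) / qPoch q q (2 * (N + 1))) =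
        (1 - q * q ^ N) * (qPoch q q N / qPoch q q (2 * N)) := by
      have e : 2 * (N + 1) = 2 * N + 1 + 1 := by ring
      rw [e, qPoch_self_succ, qPoch_self_succ, qPoch_self_succ]
      have p1 := qPoch_self_ne_zero hq (2 * N)
      have p2 : 1 - q ^ (2 * N + 1 + 1) = 1 - q ^ 2 * (q ^ N) ^ 2 := by ring
      have p3 : 1 - q ^ (2 * N + 1) = 1 - q * (q ^ N) ^ 2 := by ring
      have p4 : 1 - q ^ (N + 1) = 1 - q * q ^ N := by ring
      rw [p2, p3, p4]
      field_simp
    -- the polynomial side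
    have r0 := rogersSzego_three_term h0 hq N 0
    have r1 := rogersSzego_three_term h0 hq N 1
    have r2 := rogersSzego_three_term h0 hq N 2
    have r3 := rogersSzego_three_term h0 hq N 3
    have s1 := rogersSzego_three_term h0 hq (N + 1) 1
    have s2 := rogersSzego_three_term h0 hq (N + 1) 2
    have s3 := rogersSzego_three_term h0 hq (N + 1) 3
    have u0 := rogersSzego_succ_sub_add_one h0 hq N 0
    have u1 := rogersSzego_succ_sub_sub_one h0 hq N 1
    -- the theta side
    have v1 := pentSum_even_recurrence h0 hq 0 N
    have v2 := pentSum_even_recurrence h0 hq 1 N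
    have v3 := pentSum_odd_recurrence h0 hq 0 N
    have v4 := pentSum_odd_recurrence h0 hq (-1) N
    -- The even recurrence at `d = 2` would need an odd sum with `d = 4`, outside the family. This
    -- relation instead gives `d = 2` at level `N + 1` from `d = 0, 1` there and `d = 0` at level
    -- `N`.
    have v5 := pentSum_sub_one_sub_one h0 hq 0 (N + 1) (N + 1)
    have w1 := pentSum_odd_antisymm h0 1 N
    have w2 := pentSum_odd_antisymm h0 2 N
    have w3 := pentSum_odd_antisymm h0 3 N
    have w4 := pentSum_comm q (-2) (N + 1) (N + 1)
    have k1 : q ^ (2 * (N : ℤ) + 1) = q * (q ^ N) ^ 2 := by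
      rw [← pow_mul, ← pow_succ']; norm_cast; ring_nf
    have k2 : q ^ (2 * (N : ℤ) + 2) = q ^ 2 * (q ^ N) ^ 2 := by
      rw [← pow_mul, ← pow_add]; norm_cast; ring_nf
    have k3 : q ^ ((N : ℤ) + 1) = q * q ^ N := by rw [← pow_succ']; norm_cast
    have k4 : q ^ ((N : ℤ) + 1 + 1) = q ^ 2 * q ^ N := by
      rw [← pow_add]; norm_cast; ring_nf
    norm_num [k1, k2, k3, k4] at v1 v2 v3 v4 w1 w2 w3 w4
    rw [← add_assoc, add_right_comm (N : ℤ), add_assoc (_ + _) (1 : ℤ), ← two_mul,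
      one_add_one_eq_two, k2, k3, zero_sub, zero_add, w4] at v5
    norm_num [pow_succ'] at r0 r1 r2 r3 s1 s2 s3 u0 u1
    have x1 : (N : ℤ) + 1 - 1 = N := by ring
    have w1' : pentSum q 1 (N - 1) (N + 1) = 0 := by linear_combination w1 / 2
    rw [w1', w2, i1, i3] at v1
    rw [w3, i2, i3, i5] at v2
    rw [i1, i2, i3] at v3
    rw [i2, i4, i5] at v4
    rw [x1, i1] at v5
    rw [Nat.cast_succ, x1, add_assoc, one_add_one_eq_two]
    clear w1 w2 w3 w4 w1' i1 i2 i3 i4 i5 k1 k2 k3 k4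
    generalize qPoch q q N / qPoch q q (2 * N) = c at *
    generalize qPoch q q (N + 1) / qPoch q q (2 * (N + 1)) = c' at *
    generalize rogersSzego q (N + 1) 0 = f0 at *
    generalize rogersSzego q (N + 1) 1 = f1 at *
    generalize rogersSzego q (N + 1) 2 = f2 at *
    generalize rogersSzego q (N + 1) 3 = f3 at *
    generalize rogersSzego q (N + 1) 4 = f4 at *
    generalize rogersSzego q N 0 = g0 at *
    generalize rogersSzego q N 1 = g1 at *
    generalize rogersSzego q N 2 = g2 at *
    generalize rogersSzego q N 3 = g3 at *
    generalize rogersSzego q N 4 = g4 at *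
    generalize rogersSzego q N (-1) = gm at *
    generalize q ^ N = y at *
    have hD := mul_ne_zero d2 d3
    -- From here all data are eliminated in favour of `q`, `y = q^N`, `c'`, `g0` and `g1`, after
    -- which each claim is a rational function identity.
    obtain rfl : c = (1 - q ^ 2 * y ^ 2) * (1 - q * y ^ 2) * c' / (1 - q * y) := by
      rw [hc]; field_simp
    have i : ∀ a b x z : ℂ, y * (a - b) = x * (a - z) → b = a - x / y * (a - z) := by
      intro a b x z h
      field_simp
      linear_combination -h
    obtain rfl := i _ _ _ _ r3
    obtain rfl := i _ _ _ _ r2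
    obtain rfl := i _ _ _ _ r1
    obtain rfl : gm = (g0 - y * (g0 - g1)) / y := by
      field_simp; linear_combination r0
    have j : ∀ a b x z : ℂ, q * y * (a - b) = q * x * (a - z) → b = a - x / y * (a - z) := by
      intro a b x z h
      field_simp
      apply mul_left_cancel₀ h0
      linear_combination -h
    obtain rfl := j _ _ _ _ s3
    obtain rfl := j _ _ _ _ s2
    obtain rfl := j _ _ 1 _ (by rw [mul_one]; exact s1)
    obtain rfl : f1 = q * y * f0 + q * y * y * g0 := by linear_combination u1
    obtain rfl : f0 = (g0 - y * (g0 - g1) + q * y ^ 2 * g0) / (1 - q * y) := by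
      field_simp at u0 ⊢
      linear_combination u0
    clear hc r0 r1 r2 r3 s1 s2 s3 u0 u1 i j
    have t0 : ∀ x z : ℂ, (1 - q ^ 2 * y ^ 2) * (1 - q * y ^ 2) * x = z →
      x = z / ((1 - q ^ 2 * y ^ 2) * (1 - q * y ^ 2)) := by
      intro x z h
      rw [eq_div_iff hD, ← h, mul_comm]
    have e1 := t0 _ _ v1
    have e2 := t0 _ _ v2
    have e3 := t0 _ _ v3
    have e4 := t0 _ _ v4
    have e5 : pentSum q 2 (N + 1) (N + 1) = ((1 + q ^ 2 * y ^ 2) * pentSum q 0 (N + 1) (N + 1) -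
        (1 - q ^ 2 * y ^ 2) * (1 - q * y ^ 2) * c' / (1 - q * y) * g0) / (q * y) -
        pentSum q 1 (N + 1) (N + 1) := by
      rw [v5]; field_simp; ring
    rw [e1, e2] at e5
    clear v1 v2 v3 v4 v5 t0 hD
    refine ⟨⟨e1.trans ?_, e2.trans ?_, e3.trans ?_⟩, e5.trans ?_, e4.trans ?_⟩
    · field_simp; ring
    · field_simp; ring
    · field_simp; ring
    · field_simp; ring
    · field_simp; ring

/-! ### Limits, Durfee sums and the limiting Bailey lemma -/

theorem tendsto_qPoch {q : ℂ} (hq : ‖q‖ < 1) (a : ℂ) :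
    Tendsto (qPoch a q) atTop (𝓝 (qPochInf a q)) :=
  (qPochInf_hasProd a q hq).tendsto_prod_nat

theorem qPochInf_self_ne_zero {q : ℂ} (hq : ‖q‖ < 1) : qPochInf q q ≠ 0 := by
  have h := tprod_one_add_ne_zero_of_summable (f := fun j : ℕ => -(q * q ^ j)) (fun j => by
    rw [← sub_eq_add_neg, ← pow_succ']
    exact one_sub_pow_ne_zero hq j.succ_ne_zero) (by
    simp only [norm_neg, norm_mul, norm_pow]
    exact (summable_geometric_of_lt_one (norm_nonneg q) hq).mul_left _)
  simp only [← sub_eq_add_neg] at h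
  exact h

theorem tendsto_qPochRecip {q : ℂ} (hq : ‖q‖ < 1) (a : ℤ) :
    Tendsto (fun n : ℕ => qPochRecip q (n + a)) atTop (𝓝 (qPochInf q q)⁻¹) := by
  have h := ((tendsto_qPoch hq q).inv₀ (qPochInf_self_ne_zero hq)).comp
    (tendsto_atTop_atTop.mpr fun b => ⟨b + a.natAbs, fun n hn => by omega⟩ :
      Tendsto (fun n : ℕ => ((n : ℤ) + a).toNat) atTop atTop)
  refine h.congr' ?_
  filter_upwards [eventually_ge_atTop a.natAbs] with n hn
  simp [qPochRecip, show 0 ≤ (n : ℤ) + a by omega]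

theorem exists_norm_qPochRecip_le {q : ℂ} (hq : ‖q‖ < 1) : ∃ W, ∀ k : ℤ, ‖qPochRecip q k‖ ≤ W := by
  obtain ⟨W, hW⟩ := (Metric.isBounded_range_of_tendsto _
    (tendsto_qPochRecip hq 0)).exists_norm_le
  refine ⟨W, fun k => ?_⟩
  rcases lt_or_ge k 0 with h | h
  · rw [qPochRecip_of_neg q h, norm_zero]
    exact (norm_nonneg _).trans (hW _ (Set.mem_range_self 0))
  · refine hW _ ⟨k.toNat, ?_⟩
    simp [h]

/-- The Durfee-type sum `∑_k q^{k² + ak} / ((q; q)_k (q; q)_{k+a})`. -/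
noncomputable def durfeeSum (q : ℂ) (a : ℕ) : ℂ :=
  ∑' k : ℕ, q ^ (k ^ 2 + a * k) * (qPochRecip q k * qPochRecip q (k + a))

theorem norm_pow_sq_mul_le {q : ℂ} (hq : ‖q‖ < 1) {W : ℝ} (hW : ∀ k : ℤ, ‖qPochRecip q k‖ ≤ W)
    (a k : ℕ) (b c : ℤ) :
    ‖q ^ (k ^ 2 + a * k) * (qPochRecip q b * qPochRecip q c)‖ ≤ W ^ 2 * ‖q‖ ^ k := by
  rw [norm_mul, norm_mul, norm_pow, mul_comm, sq W]
  have h0 : 0 ≤ W := (norm_nonneg _).trans (hW 0)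
  refine mul_le_mul (mul_le_mul (hW _) (hW _) (norm_nonneg _) h0) ?_ (by positivity) (by positivity)
  exact pow_le_pow_of_le_one (norm_nonneg q) hq.le (by nlinarith [Nat.le_self_pow two_ne_zero k])

theorem summable_pow_sq_mul {q : ℂ} (hq : ‖q‖ < 1) (a : ℕ) (f g : ℕ → ℤ) :
    Summable fun k : ℕ => q ^ (k ^ 2 + a * k) * (qPochRecip q (f k) * qPochRecip q (g k)) := by
  obtain ⟨W, hW⟩ := exists_norm_qPochRecip_le hq
  exact Summable.of_norm_bounded ((summable_geometric_of_lt_one (norm_nonneg q) hq).mul_left _)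
    fun k => norm_pow_sq_mul_le hq hW a k _ _

/-- Both differences are compared through the intermediate sum `B`, whose second index is raised by
one without changing the power of `q`. -/
theorem durfeeSum_sub {q : ℂ} (hq : ‖q‖ < 1) (a : ℕ) :
    durfeeSum q (a + 1) - durfeeSum q a =
      -q ^ (a + 1) * (durfeeSum q (a + 2) - durfeeSum q (a + 1)) := by
  have hB := (summable_pow_sq_mul hq a (fun k => k) fun k => k + a + 1).hasSum
  set B := ∑' k : ℕ, q ^ (k ^ 2 + a * k) * (qPochRecip q k * qPochRecip q (k + a + 1))
  have hC (a : ℕ) : HasSum (fun k : ℕ => q ^ (k ^ 2 + a * k) *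
      (qPochRecip q k * qPochRecip q (k + a))) (durfeeSum q a) :=
    (summable_pow_sq_mul hq a (fun k => k) fun k => k + a).hasSum
  have h1 : durfeeSum q a = B - q ^ (a + 1) * durfeeSum q (a + 1) := by
    refine (hC a).unique ?_
    refine (hB.sub ((hC (a + 1)).mul_left (q ^ (a + 1)))).congr_fun fun k => ?_
    have e := qPochRecip_sub_one hq (k + a + 1)
    rw [add_sub_cancel_right] at e
    rw [e, show (k : ℤ) + a + 1 = (k + a + 1 : ℕ) by push_cast; ring, zpow_natCast,
      show (k : ℤ) + (a + 1 : ℕ) = (k + a + 1 : ℕ) by push_cast; ring]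
    ring
  have h2 : B - durfeeSum q (a + 1) = q ^ (a + 1) * durfeeSum q (a + 2) := by
    refine (hB.sub (hC (a + 1))).unique ?_
    rw [← hasSum_nat_add_iff' 1, Finset.sum_range_one]
    simp only [CharP.cast_eq_zero, zero_add, zero_pow two_ne_zero, mul_zero, Nat.cast_succ,
      sub_self, sub_zero]
    refine ((hC (a + 2)).mul_left (q ^ (a + 1))).congr_fun fun k => ?_
    have e := qPochRecip_sub_one hq (k + 1 : ℕ)
    rw [show ((k + 1 : ℕ) : ℤ) - 1 = k by push_cast; ring, zpow_natCast, Nat.cast_succ] at e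
    rw [e, show (k + 1 : ℤ) + a + 1 = (k + a + 2 : ℕ) by push_cast; ring,
      show (k + 1 : ℤ) + (a + 1) = (k + a + 2 : ℕ) by push_cast; ring,
      show (k : ℤ) + (a + 2 : ℕ) = (k + a + 2 : ℕ) by push_cast; ring]
    ring
  linear_combination -h1 - h2

theorem durfeeSum_succ {q : ℂ} (hq : ‖q‖ < 1) (a : ℕ) : durfeeSum q (a + 1) = durfeeSum q a := by
  obtain ⟨W, hW⟩ := exists_norm_qPochRecip_le hq
  have hs := (summable_geometric_of_lt_one (norm_nonneg q) hq).mul_left (W ^ 2)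
  have hM (a : ℕ) : ‖durfeeSum q a‖ ≤ ∑' k : ℕ, W ^ 2 * ‖q‖ ^ k :=
    tsum_of_norm_bounded hs.hasSum fun k => norm_pow_sq_mul_le hq hW a k _ _
  set M := ∑' k : ℕ, W ^ 2 * ‖q‖ ^ k
  -- Each use of `durfeeSum_sub` gains at least one factor `‖q‖` but moves `a` to `a + 1`, hence the
  -- bound uniform in `a`.
  have hn (n : ℕ) : ∀ a, ‖durfeeSum q (a + 1) - durfeeSum q a‖ ≤ ‖q‖ ^ n * (M + M) := by
    induction n with
    | zero =>
      intro a
      rw [pow_zero, one_mul]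
      exact (norm_sub_le _ _).trans (add_le_add (hM _) (hM _))
    | succ n ih =>
      intro a
      rw [durfeeSum_sub hq, norm_mul, norm_neg, norm_pow, pow_succ' ‖q‖ n, mul_assoc]
      refine mul_le_mul ?_ (ih (a + 1)) (norm_nonneg _) (norm_nonneg _)
      exact pow_le_of_le_one (norm_nonneg q) hq.le a.succ_ne_zero
  have ht := (tendsto_pow_atTop_nhds_zero_of_lt_one (norm_nonneg q) hq).mul_const (M + M)
  rw [zero_mul] at ht
  exact sub_eq_zero.mp (norm_le_zero_iff.mp (ge_of_tendsto' ht fun n => hn n a))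

/-- The sum does not depend on `a`, and as `a → ∞` only the term `k = 0` survives. -/
theorem durfeeSum_eq {q : ℂ} (hq : ‖q‖ < 1) (a : ℕ) : durfeeSum q a = (qPochInf q q)⁻¹ := by
  obtain ⟨W, hW⟩ := exists_norm_qPochRecip_le hq
  have hs := (summable_geometric_of_lt_one (norm_nonneg q) hq).mul_left (W ^ 2)
  have hconst (n : ℕ) : durfeeSum q n = durfeeSum q a := by
    have h0 (n : ℕ) : durfeeSum q n = durfeeSum q 0 := by
      induction n with
      | zero => rfl
      | succ n ih => rw [durfeeSum_succ hq, ih]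
    rw [h0 n, h0 a]
  have ht : Tendsto (durfeeSum q) atTop
      (𝓝 (∑' k : ℕ, if k = 0 then (qPochInf q q)⁻¹ else 0)) := by
    refine tendsto_tsum_of_dominated_convergence hs (fun k => ?_)
      (Eventually.of_forall fun a k => norm_pow_sq_mul_le hq hW a k _ _)
    rcases Nat.eq_zero_or_pos k with rfl | hk
    · simpa [qPochRecip_zero] using tendsto_qPochRecip hq 0
    · rw [if_neg hk.ne']
      have h1 := (tendsto_pow_atTop_nhds_zero_of_norm_lt_one hq).comp
        (tendsto_atTop_mono (fun a : ℕ => (by nlinarith : a ≤ k ^ 2 + a * k)) tendsto_id)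
      have h2 := (tendsto_qPochRecip hq k).const_mul (qPochRecip q k)
      have h3 := h1.mul h2
      rw [zero_mul] at h3
      refine h3.congr fun n => ?_
      simp only [Function.comp_apply, add_comm (n : ℤ)]
  rw [tsum_ite_eq] at ht
  exact tendsto_nhds_unique (tendsto_const_nhds.congr fun n => (hconst n).symm) ht

/-- Terms with `N < |m|` vanish; putting `N = k + |m|` leaves a Durfee sum with parameter `2|m|`. -/
theorem hasSum_pow_sq_mul_qPochRecip {q : ℂ} (hq : ‖q‖ < 1) (m : ℤ) :
    HasSum (fun N : ℕ => q ^ N ^ 2 * (qPochRecip q (N - m) * qPochRecip q (N + m)))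
      (q ^ m.natAbs ^ 2 * (qPochInf q q)⁻¹) := by
  have key (a : ℕ) : HasSum (fun N : ℕ => q ^ N ^ 2 * (qPochRecip q (N - a) * qPochRecip q (N + a)))
      (q ^ a ^ 2 * (qPochInf q q)⁻¹) := by
    rw [← (add_left_injective a).hasSum_iff]
    · have h := (summable_pow_sq_mul hq (2 * a) (fun k => k) fun k => k + (2 * a : ℕ)).hasSum
      have h2 := h.mul_left (q ^ a ^ 2)
      change HasSum _ (q ^ a ^ 2 * durfeeSum q (2 * a)) at h2
      rw [durfeeSum_eq hq] at h2
      convert h2 using 2 with k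
      simp only [Function.comp_apply, ← mul_assoc, ← pow_add]
      congr 2
      · ring
      · rw [Nat.cast_add]; ring_nf
      · push_cast; ring
    · intro N hN
      have : N < a := by
        by_contra h
        exact hN ⟨N - a, Nat.sub_add_cancel (not_lt.mp h)⟩
      rw [qPochRecip_of_neg q (by omega : (N : ℤ) - a < 0)]
      simp
  rcases Int.natAbs_eq m with h | h
  · have := key m.natAbs
    rwa [← h] at this
  · have := key m.natAbs
    rw [show ((m.natAbs : ℕ) : ℤ) = -m by omega] at this
    convert this using 1
    ext N
    rw [sub_neg_eq_add, ← sub_eq_add_neg, mul_comm (qPochRecip q _)]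

/-! ### Theta series and the Jacobi triple product -/

theorem summable_pow_natAbs {r : ℝ} (h0 : 0 ≤ r) (h1 : r < 1) :
    Summable fun j : ℤ => r ^ j.natAbs :=
  Summable.of_nat_of_neg (by simpa using summable_geometric_of_lt_one h0 h1)
    (by simpa using summable_geometric_of_lt_one h0 h1)

/-- A crude completion of the square: `j(3j+1)/2 + dj ≥ |j| - (|d|+2)²`. -/
theorem norm_pentWeight_le {q : ℂ} (h0 : q ≠ 0) (hq : ‖q‖ < 1) (d j : ℤ) :
    ‖pentWeight q d j‖ ≤ ‖q‖ ^ (-(|d| + 2) ^ 2) * ‖q‖ ^ j.natAbs := by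
  have hp : 0 < ‖q‖ := norm_pos_iff.mpr h0
  have h1 := pentagonal_div_two j
  rw [pentWeight, norm_mul, norm_zpow, norm_zpow, norm_neg, norm_one, one_zpow, one_mul,
    ← zpow_natCast, ← zpow_add₀ hp.ne', Int.natCast_natAbs]
  refine zpow_le_zpow_right_of_le_one₀ hp hq.le ?_
  have h2 : -(|d| * |j|) ≤ d * j := by rw [← abs_mul]; exact neg_abs_le _
  have h3 : -|j| ≤ j := neg_abs_le j
  have h4 : |j| * |j| = j * j := abs_mul_abs_self j
  nlinarith [sq_nonneg (|j| - (|d| + 2)), sq_nonneg |j|, abs_nonneg j, abs_nonneg d]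

theorem summable_pentWeight_mul {q : ℂ} (h0 : q ≠ 0) (hq : ‖q‖ < 1) (d : ℤ) :
    Summable fun j : ℤ => ‖pentWeight q d j * q ^ (4 * j ^ 2)‖ := by
  refine Summable.of_nonneg_of_le (fun j => norm_nonneg _) (fun j => ?_)
    ((summable_pow_natAbs (norm_nonneg q) hq).mul_left (‖q‖ ^ (-(|d| + 2) ^ 2)))
  rw [norm_mul]
  refine (mul_le_of_le_one_right (norm_nonneg _) ?_).trans (norm_pentWeight_le h0 hq d j)
  lift 4 * j ^ 2 to ℕ using by positivity with m
  rw [zpow_natCast, norm_pow]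
  exact pow_le_one₀ (norm_nonneg q) hq.le

/-- The signed power `(-1)^j q^{j(j-1)/2} z^j`. -/
noncomputable def thetaWeight (q z : ℂ) (j : ℤ) : ℂ :=
  (-1) ^ j * q ^ (j * (j - 1) / 2) * z ^ j

theorem triangular_div_two (j : ℤ) : 2 * (j * (j - 1) / 2) = j * (j - 1) := by
  apply Int.mul_ediv_cancel'
  rcases Int.even_or_odd j with ⟨k, rfl⟩ | ⟨k, rfl⟩
  · exact ⟨k * (k + k - 1), by ring⟩
  · exact ⟨(2 * k + 1) * k, by ring⟩

theorem thetaWeight_add_one {q z : ℂ} (h0 : q ≠ 0) (hz : z ≠ 0) (j : ℤ) :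
    thetaWeight q z (j + 1) = -q ^ j * z * thetaWeight q z j := by
  have h1 := triangular_div_two j
  have h2 := triangular_div_two (j + 1)
  have : (j + 1) * (j + 1 - 1) / 2 = j + j * (j - 1) / 2 := by linarith
  rw [thetaWeight, thetaWeight, this, zpow_add₀ h0, zpow_add_one₀ hz,
    zpow_add_one₀ (by norm_num)]
  ring

/-- In the recurrence for products of reciprocals, the outer terms are the level-`N` term at `j ∓
1`. Summing over `j` multiplies the level-`N` sum by `(1 - zq^N)(1 - q^{N+1}/z)`, up to the
denominator. -/
theorem finite_triple_product {q z : ℂ} (h0 : q ≠ 0) (hq : ‖q‖ < 1) (hz : z ≠ 0) (N : ℕ) :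
    HasSum (fun j : ℤ => thetaWeight q z j * (qPochRecip q (N - j) * qPochRecip q (N + j)))
      (qPoch z q N * qPoch (q / z) q N * qPochRecip q (2 * N : ℕ)) := by
  induction N with
  | zero =>
    convert hasSum_single (0 : ℤ) fun j hj => ?_ using 1
    · simp [qPoch_zero, qPochRecip_zero, thetaWeight]
    · rcases lt_or_gt_of_ne hj with h | h
      · rw [qPochRecip_of_neg q (by omega : ((0 : ℕ) : ℤ) + j < 0)]; simp
      · rw [qPochRecip_of_neg q (by omega : ((0 : ℕ) : ℤ) - j < 0)]; simp
  | succ N ih =>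
    set S := qPoch z q N * qPoch (q / z) q N * qPochRecip q (2 * N : ℕ)
    have d1 : 1 - q ^ (2 * N + 2) ≠ 0 := one_sub_pow_ne_zero hq (by omega)
    have d2 : 1 - q ^ (2 * N + 1) ≠ 0 := one_sub_pow_ne_zero hq (by omega)
    have hT (c : ℤ) (x : ℂ) := (((Equiv.addRight c).hasSum_iff).mpr ih).mul_left x
    have h := ((hT (-1) (-(q ^ N * z))).add (hT 0 (1 + q ^ (2 * N + 1)))).add
      (hT 1 (-(q ^ (N + 1) / z)))
    have h' := h.mul_left (((1 - q ^ (2 * N + 2)) * (1 - q ^ (2 * N + 1)))⁻¹)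
    have hv : qPoch z q (N + 1) * qPoch (q / z) q (N + 1) * qPochRecip q (2 * (N + 1) : ℕ) =
        ((1 - q ^ (2 * N + 2)) * (1 - q ^ (2 * N + 1)))⁻¹ *
          (-(q ^ N * z) * S + (1 + q ^ (2 * N + 1)) * S + -(q ^ (N + 1) / z) * S) := by
      rw [eq_inv_mul_iff_mul_eq₀ (mul_ne_zero d1 d2)]
      have e1 := qPochRecip_sub_one hq (2 * N + 2 : ℕ)
      have e2 := qPochRecip_sub_one hq (2 * N + 1 : ℕ)
      rw [show ((2 * N + 2 : ℕ) - 1 : ℤ) = (2 * N + 1 : ℕ) by push_cast; ring, zpow_natCast] at e1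
      rw [show ((2 * N + 1 : ℕ) - 1 : ℤ) = (2 * N : ℕ) by push_cast; ring, zpow_natCast, e1] at e2
      simp only [S]
      rw [e2, qPoch_succ, qPoch_succ, show 2 * (N + 1) = 2 * N + 2 by ring]
      field_simp
      ring
    rw [hv]
    refine h'.congr_fun fun j => ?_
    rw [eq_inv_mul_iff_mul_eq₀ (mul_ne_zero d1 d2)]
    have r := qPochRecip_mul_recurrence h0 hq (N + 1 - j) (N + 1 + j)
    have t1 := thetaWeight_add_one h0 hz (j - 1)
    have t2 := thetaWeight_add_one h0 hz j
    rw [sub_add_cancel, zpow_sub_one₀ h0] at t1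
    simp only [Function.comp_apply, Equiv.coe_addRight]
    rw [show (N + 1 - j + (N + 1 + j) : ℤ) = (2 * N + 2 : ℕ) by push_cast; ring,
      show ((2 * N + 2 : ℕ) - 1 : ℤ) = (2 * N + 1 : ℕ) by push_cast; ring,
      show (N + 1 + j - 2 : ℤ) = N + (j + -1) by ring,
      show (N + 1 - j - 2 : ℤ) = N - (j + 1) by ring,
      show (N + 1 - j - 1 : ℤ) = N - (j + 0) by ring,
      show (N + 1 + j - 1 : ℤ) = N + (j + 0) by ring, zpow_natCast, zpow_natCast,
      show (N + 1 - j : ℤ) = N - (j + -1) by ring,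
      show (N + 1 + j : ℤ) = N + (j + 1) by ring] at r
    rw [show ((N + 1 : ℕ) - j : ℤ) = N - (j + -1) by push_cast; ring,
      show ((N + 1 : ℕ) + j : ℤ) = N + (j + 1) by push_cast; ring, mul_left_comm, r, t2,
      add_zero, ← sub_eq_add_neg, t1, zpow_sub₀ h0, zpow_sub_one₀ h0,
      zpow_add₀ h0, zpow_add_one₀ h0, zpow_natCast]
    have hj : q ^ j ≠ 0 := zpow_ne_zero j h0
    field_simp
    ring

theorem jacobi_triple_product {q z : ℂ} (h0 : q ≠ 0) (hq : ‖q‖ < 1) (hz : z ≠ 0)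
    (hs : Summable fun j => ‖thetaWeight q z j‖) :
    HasSum (thetaWeight q z) (qPochInf z q * qPochInf (q / z) q * qPochInf q q) := by
  obtain ⟨W, hW⟩ := exists_norm_qPochRecip_le hq
  have hW0 : 0 ≤ W := (norm_nonneg _).trans (hW 0)
  have hne := qPochInf_self_ne_zero hq
  have h1 : Tendsto (fun N : ℕ => ∑' j : ℤ, thetaWeight q z j *
      (qPochRecip q (N - j) * qPochRecip q (N + j))) atTop
      (𝓝 (∑' j : ℤ, thetaWeight q z j * ((qPochInf q q)⁻¹ * (qPochInf q q)⁻¹))) := by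
    refine tendsto_tsum_of_dominated_convergence (hs.mul_right (W * W)) (fun j => ?_)
      (Eventually.of_forall fun N j => ?_)
    · refine Tendsto.const_mul _ (Tendsto.mul ?_ (tendsto_qPochRecip hq j))
      simpa only [← sub_eq_add_neg] using tendsto_qPochRecip hq (-j)
    · rw [norm_mul, norm_mul]
      gcongr
      · exact hW _
      · exact hW _
  have h2 : Tendsto (fun N : ℕ => qPoch z q N * qPoch (q / z) q N * qPochRecip q (2 * N : ℕ)) atTop
      (𝓝 (qPochInf z q * qPochInf (q / z) q * (qPochInf q q)⁻¹)) := by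
    refine ((tendsto_qPoch hq z).mul (tendsto_qPoch hq _)).mul ?_
    have := (tendsto_qPochRecip hq 0).comp
      (tendsto_atTop_mono (fun N : ℕ => (by omega : N ≤ 2 * N)) tendsto_id)
    simpa [Function.comp_def] using this
  have h3 := tendsto_nhds_unique h1
    (h2.congr fun N => (finite_triple_product h0 hq hz N).tsum_eq.symm)
  rw [tsum_mul_right] at h3
  have h4 := hs.of_norm.hasSum
  field_simp at h3
  rw [h3, mul_assoc, mul_comm] at h4
  exact h4

/-! ### Summation over `N` -/

/-- An absolutely convergent double series in `(N, j)` is summed in both orders: over `j` first it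
is the left side, over `N` first a theta series of base `q^11`. -/
theorem hasSum_pentSum {q : ℂ} (h0 : q ≠ 0) (hq : ‖q‖ < 1) (d s : ℤ) :
    HasSum (fun N : ℕ => q ^ N ^ 2 * pentSum q d (N - s) (N + s))
      (q ^ s ^ 2 * qPochInf3 (q ^ (5 - d - 4 * s)) (q ^ (6 + d + 4 * s)) (q ^ 11) (q ^ 11) /
        qPochInf q q) := by
  obtain ⟨W, hW⟩ := exists_norm_qPochRecip_le hq
  have hW0 : 0 ≤ W := (norm_nonneg _).trans (hW 0)
  let F : ℕ × ℤ → ℂ := fun p => q ^ p.1 ^ 2 * (pentWeight q d p.2 *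
    (qPochRecip q (p.1 - s - 2 * p.2) * qPochRecip q (p.1 + s + 2 * p.2)))
  have hF : Summable F := by
    refine Summable.of_norm_bounded (((summable_geometric_of_lt_one (norm_nonneg q) hq).mul_of_nonneg
      ((summable_pow_natAbs (norm_nonneg q) hq).mul_left (‖q‖ ^ (-(|d| + 2) ^ 2) * (W * W)))
      (fun _ => by positivity) (fun _ => by positivity))) fun p => ?_
    have e1 : ‖q‖ ^ p.1 ^ 2 ≤ ‖q‖ ^ p.1 :=
      pow_le_pow_of_le_one (norm_nonneg q) hq.le (Nat.le_self_pow two_ne_zero _)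
    have e2 := norm_pentWeight_le h0 hq d p.2
    simp only [F, norm_mul, norm_pow]
    calc _ ≤ ‖q‖ ^ p.1 * (‖q‖ ^ (-(|d| + 2) ^ 2) * ‖q‖ ^ p.2.natAbs * (W * W)) := by
          gcongr
          · exact hW _
          · exact hW _
      _ = _ := by ring
  have h1 : HasSum (fun N : ℕ => q ^ N ^ 2 * pentSum q d (N - s) (N + s)) (∑' p, F p) := by
    refine hF.hasSum.prod_fiberwise fun N => ?_
    have h := (summable_qPochRecip_mul q (pentWeight q d) (N - s) (N + s)).hasSum.mul_left (q ^ N ^ 2)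
    exact h
  have h2 : HasSum (fun j : ℤ => pentWeight q d j * (q ^ (2 * j + s).natAbs ^ 2 *
      (qPochInf q q)⁻¹)) (∑' p, F p) := by
    refine ((Equiv.prodComm ℤ ℕ).hasSum_iff.mpr hF.hasSum).prod_fiberwise fun j => ?_
    refine ((hasSum_pow_sq_mul_qPochRecip hq (2 * j + s)).mul_left (pentWeight q d j)).congr_fun
      fun N => ?_
    simp only [F, Function.comp_apply, Equiv.prodComm_apply, Prod.swap]
    rw [mul_left_comm, show (N - (2 * j + s) : ℤ) = N - s - 2 * j by ring,
      show (N + (2 * j + s) : ℤ) = N + s + 2 * j by ring]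
  have e (j : ℤ) : thetaWeight (q ^ 11) (q ^ (6 + d + 4 * s)) j =
      pentWeight q (d + 4 * s) j * q ^ (4 * j ^ 2) := by
    have a1 := triangular_div_two j
    have a2 := pentagonal_div_two j
    rw [thetaWeight, pentWeight, mul_assoc, mul_assoc, ← zpow_natCast q 11, ← zpow_mul, ← zpow_mul,
      ← zpow_add₀ h0, ← zpow_add₀ h0]
    congr 2
    push_cast
    linarith
  have hq' : ‖q ^ 11‖ < 1 := by
    rw [norm_pow]; exact pow_lt_one₀ (norm_nonneg q) hq (by norm_num)
  have h3 := jacobi_triple_product (pow_ne_zero 11 h0) hq' (zpow_ne_zero (6 + d + 4 * s) h0)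
    (by simp only [e]; exact summable_pentWeight_mul h0 hq _)
  have h4 := (h3.mul_left (q ^ s ^ 2)).mul_right (qPochInf q q)⁻¹
  have h5 := h4.unique (h2.congr_fun fun j => ?_)
  · rw [← h5] at h1
    convert h1 using 1
    rw [qPochInf3, ← zpow_natCast q 11, ← zpow_sub₀ h0]
    push_cast
    rw [show (11 : ℤ) - (6 + d + 4 * s) = 5 - d - 4 * s by ring]
    ring
  · rw [e, ← zpow_mul_pentWeight h0, ← zpow_natCast q (_ ^ 2)]
    push_cast
    rw [sq_abs,
      show (2 * j + s) ^ 2 = s ^ 2 + 4 * s * j + 4 * j ^ 2 by ring, zpow_add₀ h0, zpow_add₀ h0]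
    ring

/-! ### Passage between double series and antidiagonal sums -/

theorem exists_norm_qPoch_le {q : ℂ} (hq : ‖q‖ < 1) (a : ℂ) : ∃ W, ∀ m, ‖qPoch a q m‖ ≤ W := by
  obtain ⟨W, hW⟩ := (Metric.isBounded_range_of_tendsto _ (tendsto_qPoch hq a)).exists_norm_le
  exact ⟨W, fun m => hW _ ⟨m, rfl⟩⟩

theorem summable_qPoch_double {q : ℂ} (hq : ‖q‖ < 1) (A : ℕ → ℂ) (hA : ∃ C, ∀ n, ‖A n‖ ≤ C)
    (E u v : ℕ → ℕ → ℕ) (hE : ∀ n r, n + r ≤ E n r) :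
    Summable (Function.uncurry fun n r : ℕ => q ^ E n r * qPoch q q (u n r) * A n /
      (qPoch q q (v n r) * qPoch q q r * qPoch q q n)) := by
  obtain ⟨C, hC⟩ := hA
  obtain ⟨W, hW⟩ := exists_norm_qPochRecip_le hq
  obtain ⟨V, hV⟩ := exists_norm_qPoch_le hq q
  have hC0 : 0 ≤ C := (norm_nonneg _).trans (hC 0)
  have hW0 : 0 ≤ W := (norm_nonneg _).trans (hW 0)
  have hV0 : 0 ≤ V := (norm_nonneg _).trans (hV 0)
  have hW' (k : ℕ) : ‖(qPoch q q k)⁻¹‖ ≤ W := by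
    rw [← qPochRecip_natCast]; exact hW k
  have hg := summable_geometric_of_lt_one (norm_nonneg q) hq
  refine Summable.of_norm_bounded ((hg.mul_of_nonneg (hg.mul_left (V * C * (W * W * W)))
    (fun _ => by positivity) (fun _ => by positivity))) ?_
  rintro ⟨n, r⟩
  simp only [Function.uncurry_apply_pair]
  rw [div_eq_mul_inv, mul_inv, mul_inv]
  simp only [norm_mul, norm_pow]
  have h1 : ‖q‖ ^ E n r ≤ ‖q‖ ^ (n + r) := pow_le_pow_of_le_one (norm_nonneg q) hq.le (hE n r)
  calc _ ≤ ‖q‖ ^ (n + r) * V * C * (W * W * W) := by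
        gcongr
        · exact hV _
        · exact hC _
        · exact hW' _
        · exact hW' _
        · exact hW' _
    _ = _ := by rw [pow_add]; ring

theorem HasSum.of_antidiagonal {f : ℕ × ℕ → ℂ} {a : ℂ} (hf : Summable f)
    (h : HasSum (fun N => ∑ p ∈ Finset.HasAntidiagonal.antidiagonal N, f p) a) : HasSum f a := by
  have h1 := Finset.HasAntidiagonal.sigmaAntidiagonalEquivProd.hasSum_iff.mpr hf.hasSum
  have h2 := h1.sigma fun N => hasSum_fintype _
  rw [h.unique (h2.congr_fun fun N => ?_)]
  · exact hf.hasSum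
  · exact (Finset.sum_coe_sort _ f).symm

theorem exists_norm_comp_pow_le {q : ℂ} (hq : ‖q‖ < 1) {P : ℂ → ℂ} (hP : Continuous P) :
    ∃ C, ∀ n : ℕ, ‖P (q ^ n)‖ ≤ C := by
  obtain ⟨C, hC⟩ := (Metric.isBounded_range_of_tendsto _ ((hP.tendsto 0).comp
    (tendsto_pow_atTop_nhds_zero_of_norm_lt_one hq))).exists_norm_le
  exact ⟨C, fun n => hC _ ⟨n, rfl⟩⟩

theorem hasSum_qPoch_double_even {q : ℂ} (hq : ‖q‖ < 1) {P : ℂ → ℂ} (hP : Continuous P) {a : ℂ}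
    {S : ℕ → ℂ} (hS : HasSum (fun N => q ^ N ^ 2 * S N) a)
    (h : ∀ N, S N = qPoch q q N / qPoch q q (2 * N) *
      ∑ p ∈ Finset.HasAntidiagonal.antidiagonal N,
        P (q ^ p.1) * q ^ (N * p.2) / (qPoch q q p.1 * qPoch q q p.2)) :
    HasSum (Function.uncurry fun n r : ℕ =>
      q ^ (n ^ 2 + 2 * r ^ 2 + 3 * n * r) * qPoch q q (n + r) * P (q ^ n) /
        (qPoch q q (2 * n + 2 * r) * qPoch q q r * qPoch q q n)) a := by
  refine HasSum.of_antidiagonal (summable_qPoch_double hq (fun n => P (q ^ n))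
    (exists_norm_comp_pow_le hq hP) (fun n r => n ^ 2 + 2 * r ^ 2 + 3 * n * r) (fun n r => n + r)
    (fun n r => 2 * n + 2 * r) fun n r => ?_) (hS.congr_fun fun N => ?_)
  · nlinarith [Nat.le_self_pow two_ne_zero n, Nat.le_self_pow two_ne_zero r]
  · rw [h, ← mul_assoc, Finset.mul_sum]
    refine Finset.sum_congr rfl fun p hp => ?_
    obtain rfl : p.1 + p.2 = N := Finset.HasAntidiagonal.mem_antidiagonal.mp hp
    have h1 := qPoch_self_ne_zero hq p.1
    have h2 := qPoch_self_ne_zero hq p.2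
    have h3 := qPoch_self_ne_zero hq (2 * (p.1 + p.2))
    rw [Function.uncurry, ← mul_add]
    field_simp
    ring

/-- The factor `1 - q^n` removes the terms with `n = 0`. Replacing `n` by `n + 1` then produces the
linear exponents `2n + 3r` and an extra `q`, which is why the hypothesis has sum `q * a`. -/
theorem hasSum_qPoch_double_odd {q : ℂ} (h0 : q ≠ 0) (hq : ‖q‖ < 1) {P : ℂ → ℂ} (hP : Continuous P)
    {a : ℂ} {S : ℕ → ℂ} (hS : HasSum (fun N => q ^ N ^ 2 * S N) (q * a))
    (h : ∀ N, S N = qPoch q q N / qPoch q q (2 * N) *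
      ∑ p ∈ Finset.HasAntidiagonal.antidiagonal N,
        (1 - q ^ p.1) * P (q ^ p.1) * q ^ (N * p.2) / (qPoch q q p.1 * qPoch q q p.2)) :
    HasSum (Function.uncurry fun n r : ℕ =>
      q ^ (n ^ 2 + 2 * r ^ 2 + 3 * n * r + 2 * n + 3 * r) * qPoch q q (n + r + 1) *
        P (q * q ^ n) / (qPoch q q (2 * n + 2 * r + 2) * qPoch q q r * qPoch q q n)) a := by
  have hS0 : S 0 = 0 := by simp [h]
  rw [← hasSum_nat_add_iff' 1, Finset.sum_range_one, hS0, mul_zero, sub_zero] at hS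
  have hS' := hS.mul_left q⁻¹
  rw [inv_mul_cancel_left₀ h0] at hS'
  refine HasSum.of_antidiagonal (summable_qPoch_double hq (fun n => P (q * q ^ n))
    (exists_norm_comp_pow_le hq (P := fun z => P (q * z)) (by fun_prop))
    (fun n r => n ^ 2 + 2 * r ^ 2 + 3 * n * r + 2 * n + 3 * r) (fun n r => n + r + 1)
    (fun n r => 2 * n + 2 * r + 2) fun n r => ?_) (hS'.congr_fun fun N => ?_)
  · nlinarith [Nat.zero_le (n * r)]
  · rw [h, Finset.Nat.sum_antidiagonal_succ, pow_zero, sub_self, zero_mul, zero_mul, zero_div,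
      zero_add, ← mul_assoc, ← mul_assoc, Finset.mul_sum]
    refine Finset.sum_congr rfl fun p hp => ?_
    obtain rfl : p.1 + p.2 = N := Finset.HasAntidiagonal.mem_antidiagonal.mp hp
    have h1 := qPoch_self_ne_zero hq p.1
    have h2 := qPoch_self_ne_zero hq p.2
    have h3 := qPoch_self_ne_zero hq (2 * (p.1 + p.2) + 2)
    have h4 := one_sub_pow_ne_zero hq p.1.succ_ne_zero
    rw [Function.uncurry, qPoch_self_succ q p.1, ← mul_add, mul_add 2 (p.1 + p.2), mul_one,
      pow_succ' q p.1] at *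
    field_simp
    ring

/-! ### The case `q = 0` and the five identities -/

theorem hasSum_uncurry_of_eq_zero {f : ℕ → ℕ → ℂ} {a : ℂ} (ha : f 0 0 = a)
    (h : ∀ n r, n + r ≠ 0 → f n r = 0) : HasSum (Function.uncurry f) a :=
  ha ▸ hasSum_single (0, 0) fun p hp => h _ _ fun h0 => hp (Prod.ext (by omega) (by omega))

theorem qPochInf_zero_left (q : ℂ) : qPochInf 0 q = 1 := by simp [qPochInf]

theorem qPoch_zero_left (q : ℂ) (m : ℕ) : qPoch 0 q m = 1 := by simp [qPoch]

theorem hasSum_pentSum_of_eq {q : ℂ} (h0 : q ≠ 0) (hq : ‖q‖ < 1) {d : ℤ} {k l : ℕ}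
    (hk : 5 - d = k) (hl : 6 + d = l) :
    HasSum (fun N : ℕ => q ^ N ^ 2 * pentSum q d N N)
      (qPochInf3 (q ^ k) (q ^ l) (q ^ 11) (q ^ 11) / qPochInf q q) := by
  have h := hasSum_pentSum h0 hq d 0
  simpa only [sub_zero, add_zero, mul_zero, hk, hl, zpow_natCast, zero_pow two_ne_zero, zpow_zero,
    one_mul] using h

theorem hasSum_pentSum_odd_of_eq {q : ℂ} (h0 : q ≠ 0) (hq : ‖q‖ < 1) {d : ℤ} {k l : ℕ}
    (hk : 1 - d = k) (hl : 10 + d = l) :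
    HasSum (fun N : ℕ => q ^ N ^ 2 * pentSum q d (N - 1) (N + 1))
      (q * (qPochInf3 (q ^ k) (q ^ l) (q ^ 11) (q ^ 11) / qPochInf q q)) := by
  have h := hasSum_pentSum h0 hq d 1
  rw [mul_one, show 5 - d - 4 = k by omega, show 6 + d + 4 = l by omega, one_pow, zpow_one,
    mul_div_assoc] at h
  simpa only [zpow_natCast] using h

theorem mainTheorem9 (q : ℂ) (hq : ‖q‖ < 1) :
    HasSum
      (Function.uncurry fun n r : ℕ =>
        q ^ (n ^ 2 + 2 * r ^ 2 + 3 * n * r + 2 * n + 3 * r) * qPoch q q (n + r + 1) /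
          (qPoch q q (2 * n + 2 * r + 2) * qPoch q q r * qPoch q q n))
      (qPochInf3 q (q ^ 10) (q ^ 11) (q ^ 11) / qPochInf q q) ∧
    HasSum
      (Function.uncurry fun n r : ℕ =>
        q ^ (n ^ 2 + 2 * r ^ 2 + 3 * n * r + 2 * n + 3 * r) * qPoch q q (n + r + 1) *
            (1 + q ^ (n + 1) + q ^ n - q ^ (2 * n)) /
          (qPoch q q (2 * n + 2 * r + 2) * qPoch q q r * qPoch q q n))
      (qPochInf3 (q ^ 2) (q ^ 9) (q ^ 11) (q ^ 11) / qPochInf q q) ∧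
    (q ≠ 0 →
      HasSum
        (Function.uncurry fun n r : ℕ =>
          q ^ (n ^ 2 + 2 * r ^ 2 + 3 * n * r) * qPoch q q (n + r) *
              ((q ^ ((n : ℤ) - 1) + q ^ n - q ^ (2 * (n : ℤ) - 1)) -
                (q ^ (-1 : ℤ) + q ^ ((n : ℤ) - 2) + q ^ ((n : ℤ) - 1) - q ^ (2 * (n : ℤ) - 4)) *
                  (1 - q ^ ((n : ℤ) - 1)) * (1 - q ^ n)) /
            (qPoch q q (2 * n + 2 * r) * qPoch q q r * qPoch q q n))
        (qPochInf3 (q ^ 3) (q ^ 8) (q ^ 11) (q ^ 11) / qPochInf q q)) ∧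
    (q ≠ 0 →
      HasSum
        (Function.uncurry fun n r : ℕ =>
          q ^ (n ^ 2 + 2 * r ^ 2 + 3 * n * r) * qPoch q q (n + r) *
              (q ^ ((n : ℤ) - 1) + q ^ n - q ^ (2 * (n : ℤ) - 1)) /
            (qPoch q q (2 * n + 2 * r) * qPoch q q r * qPoch q q n))
        (qPochInf3 (q ^ 4) (q ^ 7) (q ^ 11) (q ^ 11) / qPochInf q q)) ∧
    HasSum
      (Function.uncurry fun n r : ℕ =>
        q ^ (n ^ 2 + 2 * r ^ 2 + 3 * n * r) * qPoch q q (n + r) /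
          (qPoch q q (2 * n + 2 * r) * qPoch q q r * qPoch q q n))
      (qPochInf3 (q ^ 5) (q ^ 6) (q ^ 11) (q ^ 11) / qPochInf q q) := by
  -- The main argument divides by powers of `q`; at `q = 0` only the term `(0, 0)` remains and the
  -- products equal `1`.
  by_cases h0 : q = 0
  · subst h0
    have e (n r : ℕ) (h : n + r ≠ 0) : (0 : ℂ) ^ (n ^ 2 + 2 * r ^ 2 + 3 * n * r) = 0 := by
      refine zero_pow fun h' => h ?_
      nlinarith [Nat.le_self_pow two_ne_zero n, Nat.le_self_pow two_ne_zero r]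
    have hv (k l : ℕ) (hk : k ≠ 0) (hl : l ≠ 0) :
        qPochInf3 (0 ^ k) (0 ^ l) (0 ^ 11) (0 ^ 11) / qPochInf 0 0 = 1 := by
      simp [qPochInf3, qPochInf_zero_left, hk, hl]
    refine ⟨?_, ?_, fun h => absurd rfl h, fun h => absurd rfl h, ?_⟩
    · have := hv 1 10 one_ne_zero (by norm_num)
      rw [pow_one] at this
      rw [this]
      refine hasSum_uncurry_of_eq_zero ?_ fun n r h => ?_
      · simp [qPoch_zero_left]
      · simp [pow_add, e n r h]
    · rw [hv 2 9 two_ne_zero (by norm_num)]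
      refine hasSum_uncurry_of_eq_zero ?_ fun n r h => ?_
      · simp [qPoch_zero_left]
      · simp [pow_add, e n r h]
    · rw [hv 5 6 (by norm_num) (by norm_num)]
      refine hasSum_uncurry_of_eq_zero ?_ fun n r h => ?_
      · simp [qPoch_zero_left]
      · simp [e n r h]
  · refine ⟨?_, ?_, fun _ => ?_, fun _ => ?_, ?_⟩
    · have h := hasSum_qPoch_double_odd h0 hq (P := fun _ => 1) continuous_const
        (hasSum_pentSum_odd_of_eq h0 hq (d := 0) (k := 1) (l := 10) rfl rfl) fun N => by
          rw [(pentSum_eq_rogersSzego h0 hq N).1.2.2, rogersSzego, rogersSzego,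
            ← Finset.sum_sub_distrib]
          congr 1
          refine Finset.sum_congr rfl fun p _ => ?_
          simp only [zpow_zero, zpow_one, one_pow]
          ring
      simpa only [mul_one, pow_one] using h
    · have h := hasSum_qPoch_double_odd h0 hq
        -- Multiplied by `1 - z`, this is the polynomial whose coefficients appear in the identity
        -- for `d = -1`.
        (P := fun z => 1 + z + q⁻¹ * z - (q⁻¹ * z) ^ 2) (by fun_prop)
        (hasSum_pentSum_odd_of_eq h0 hq (d := -1) (k := 2) (l := 9) rfl rfl) fun N => by
          rw [(pentSum_eq_rogersSzego h0 hq N).2.2]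
          simp only [rogersSzego, Finset.mul_sum, ← Finset.sum_sub_distrib,
            ← Finset.sum_add_distrib]
          refine Finset.sum_congr rfl fun p _ => ?_
          simp only [zpow_ofNat, ← pow_mul, mul_comm _ p.1]
          simp only [pow_mul]
          ring
      refine h.congr_fun fun p => ?_
      simp only [Function.uncurry]
      congr 2
      field_simp
      ring
    · have h := hasSum_qPoch_double_even hq
        (P := fun z => q⁻¹ * z + z - q⁻¹ * z ^ 2 - (q⁻¹ + q⁻¹ ^ 2 * z + q⁻¹ * z - q⁻¹ ^ 4 * z ^ 2) *
          (1 - q⁻¹ * z) * (1 - z)) (by fun_prop)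
        (hasSum_pentSum_of_eq h0 hq (d := 2) (k := 3) (l := 8) rfl rfl) fun N => by
          rw [(pentSum_eq_rogersSzego h0 hq N).2.1]
          simp only [rogersSzego, Finset.mul_sum, ← Finset.sum_sub_distrib,
            ← Finset.sum_add_distrib]
          refine Finset.sum_congr rfl fun p _ => ?_
          simp only [zpow_ofNat, ← pow_mul, mul_comm _ p.1]
          simp only [pow_mul]
          ring
      refine h.congr_fun fun p => ?_
      simp only [Function.uncurry]
      congr 2
      simp only [zpow_sub₀ h0, zpow_neg, zpow_natCast, zpow_ofNat, mul_comm (2 : ℤ),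
        zpow_mul]
      field_simp
    · have h := hasSum_qPoch_double_even hq
        (P := fun z => q⁻¹ * z + z - q⁻¹ * z ^ 2) (by fun_prop)
        (hasSum_pentSum_of_eq h0 hq (d := 1) (k := 4) (l := 7) rfl rfl) fun N => by
          rw [(pentSum_eq_rogersSzego h0 hq N).1.2.1]
          simp only [rogersSzego, Finset.mul_sum, ← Finset.sum_sub_distrib]
          refine Finset.sum_congr rfl fun p _ => ?_
          simp only [zpow_ofNat, ← pow_mul, mul_comm _ p.1]
          simp only [pow_mul]
          ring
      refine h.congr_fun fun p => ?_
      simp only [Function.uncurry]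
      congr 2
      simp only [zpow_sub₀ h0, zpow_natCast, zpow_ofNat, mul_comm (2 : ℤ), zpow_mul]
      field_simp
    · have h := hasSum_qPoch_double_even hq (P := fun _ => 1) continuous_const
        (hasSum_pentSum_of_eq h0 hq (d := 0) (k := 5) (l := 6) rfl rfl) fun N => by
          rw [(pentSum_eq_rogersSzego h0 hq N).1.1, rogersSzego]
          simp only [zpow_zero, one_pow]
      simpa only [mul_one] using h
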